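/- Let $n\ge 2$ be even and consider $n$ agents with states $\Gamma_1,\dots,\Gamma_n$ on the unit sphere $S^2\subset\mathbb{R}^3$, indices being taken modulo $n$. The inter-agent graph is the undirected ring, with neighbour sets $\mathcal{N}_i=\{i-1,i+1\}$ (a single neighbour if $n=2$), and the closed-loop system is $$\dot\Gamma_i=\Gamma_i\times\sum_{j\in\mathcal{N}_i}\Gamma_i\times\Gamma_j,\qquad i=1,\dots,n,$$ on the state space $(S^2)^n$, with metric $d(\Gamma,\bar\Gamma)=\max_i\arccos(\Gamma_i^T\bar\Gamma_i)$ and $d_{M}(\Gamma)=\inf_{\bar\Gamma\in M}d(\Gamma,\bar\Gamma)$ for $M\subset(S^2)^n$ nonempty. A trajectory is a solution on $[0,\infty)$. A nonempty set $M$ is called stable if for every $\varepsilon>0$ there is $\delta>0$ such that every trajectory with $d_M(\Gamma(0))<\delta$ satisfies $d_M(\Gamma(t))<\varepsilon$ for all $t\ge 0$; it is asymptotically stable if moreover there is $\delta>0$ such that $d_M(\Gamma(t))\to0$ as $t\to\infty$ for every trajectory with $d_M(\Gamma(0))<\delta$. Let $\mathcal{D}$ be the set of all equilibria, call its connected components the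 equilibrium manifolds, and let $$\mathcal{M}_e=\{\Gamma\in(S^2)^n:\ \exists\, v\in S^2\ \forall i\ \ \Gamma_i=(-1)^{i-1}v\}.$$ Then: 1. $\mathcal{D}=\{\Gamma\in(S^2)^n:\ \Gamma_{i-1}\times\Gamma_i=\Gamma_i\times\Gamma_{i+1}\ \text{for all } i\}$. 2. Every trajectory approaches one of the equilibrium manifolds: there is a connected component $C$ of $\mathcal{D}$ with $d_C(\Gamma(t))\to 0$ as $t\to\infty$ (in particular $d_{\mathcal{D}}(\Gamma(t))\to0$). 3. $\mathcal{M}_e$ is one of the equilibrium manifolds, it is asymptotically stable, and it is the only stable one: no connected component of $\mathcal{D}$ other than $\mathcal{M}_e$ is stable. Moreover, every single equilibrium $\Gamma^*\in\mathcal{D}\setminus\mathcal{M}_e$ is unstable, i.e. the set $\{\Gamma^*\}$ is not stable. -/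

import Mathlib

open Set Filter Topology

noncomputable section

namespace AttitudeRing

/-- Euclidean three-space. -/
abbrev E3 : Type := EuclideanSpace ℝ (Fin 3)

/-- The unit 2-sphere in Euclidean three-space. -/
abbrev S2 : Type := Metric.sphere (0 : E3) 1

/-- The state space: the `n`-fold product of the 2-sphere. Agents are indexed by `0, …, n - 1`,
and index arithmetic is modulo `n`. -/
abbrev State (n : ℕ) : Type := Fin n → S2

/-- The cross product `x × y` of Euclidean three-space. -/
def cross (x y : E3) : E3 := WithLp.toLp 2 (crossProduct (WithLp.ofLp x) (WithLp.ofLp y))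

/-- The geodesic distance on the 2-sphere. -/
def geoDist (x y : S2) : ℝ := Real.arccos (inner ℝ (x : E3) (y : E3))

/-- The metric on the state space: the largest geodesic distance of corresponding agents. -/
def stateDist {n : ℕ} (Γ Γ' : State n) : ℝ := ⨆ i : Fin n, geoDist (Γ i) (Γ' i)

/-- The distance from a state to a (nonempty) set of states. -/
def distTo {n : ℕ} (M : Set (State n)) (Γ : State n) : ℝ := ⨅ Γ' : M, stateDist Γ (Γ' : State n)

/-- The neighbours of agent `i` in the undirected ring, as a set (a single agent if `n = 2`). -/
def ringNeighbors {n : ℕ} [NeZero n] (i : Fin n) : Finset (Fin n) := {i - 1, i + 1}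

/-- The closed-loop vector field: `Γ i × ∑ j, Γ i × Γ j`, with `j` ranging over the neighbours
of `i`. -/
def closedLoopField {n : ℕ} [NeZero n] (Γ : State n) (i : Fin n) : E3 :=
  cross (Γ i) (∑ j ∈ ringNeighbors i, cross (Γ i) (Γ j))

/-- Trajectories of the closed-loop system on the time interval `[0, ∞)`
(values at negative times are irrelevant). -/
def IsTrajectory {n : ℕ} [NeZero n] (Γ : ℝ → State n) : Prop :=
  ∀ t : ℝ, 0 ≤ t → ∀ i : Fin n,
    HasDerivWithinAt (fun s : ℝ => (Γ s i : E3)) (closedLoopField (Γ t) i) (Ici 0) t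

/-- The set of all equilibria of the closed-loop system. -/
def equilibriumSet (n : ℕ) [NeZero n] : Set (State n) :=
  {Γ | ∀ i : Fin n, closedLoopField Γ i = 0}

/-- The equilibrium manifolds: the connected components of the set of all equilibria. -/
def IsEquilibriumManifold {n : ℕ} [NeZero n] (C : Set (State n)) : Prop :=
  ∃ Γ ∈ equilibriumSet n, C = connectedComponentIn (equilibriumSet n) Γ

/-- The antipodal formation manifold. -/
def antipodalManifold (n : ℕ) : Set (State n) :=
  {Γ | ∃ v : S2, ∀ i : Fin n, (Γ i : E3) = (-1 : ℝ) ^ (i : ℕ) • (v : E3)}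

/-- Lyapunov stability of a set of states. -/
def IsStable {n : ℕ} [NeZero n] (M : Set (State n)) : Prop :=
  ∀ ε : ℝ, 0 < ε → ∃ δ : ℝ, 0 < δ ∧ ∀ Γ : ℝ → State n, IsTrajectory Γ →
    distTo M (Γ 0) < δ → ∀ t : ℝ, 0 ≤ t → distTo M (Γ t) < ε

/-- A trajectory approaches a set of states as time tends to infinity. -/
def Approaches {n : ℕ} (Γ : ℝ → State n) (M : Set (State n)) : Prop :=
  Tendsto (fun t : ℝ => distTo M (Γ t)) atTop (𝓝 0)

/-- Asymptotic stability of a set of states: stability and local attractivity. -/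
def IsAsymptoticallyStable {n : ℕ} [NeZero n] (M : Set (State n)) : Prop :=
  IsStable M ∧ ∃ δ : ℝ, 0 < δ ∧ ∀ Γ : ℝ → State n, IsTrajectory Γ →
    distTo M (Γ 0) < δ → Approaches Γ M

end AttitudeRing

end

noncomputable section

namespace AttitudeRing

/-! The system is a gradient descent. Since `x × (x × s)` is minus the tangential part of `s` at a
unit vector `x`, the `energy`, i.e. the sum of the inner products of consecutive agents, decreases
at a rate proportional to the squared norm of the field (`hasDerivWithinAt_energy`). By LaSalle's
principle the limit set of a trajectory consists of equilibria
(`mem_equilibriumSet_of_mapClusterPt`). It is also connected, so it lies in one component of the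
equilibrium set.

For stability the decisive fact is that equilibria have only finitely many energy values
(`finite_energy_image_equilibriumSet`). At an equilibrium all consecutive cross products agree. If
they are nonzero, the agents lie in a plane and each step is a rotation by `θ` or `π - θ`; closing
up the ring makes `θ` a rational angle of bounded denominator, unless the two kinds of steps balance
and the energy vanishes. Hence energy is constant on components, and equilibrium energies have gaps.
The antipodal formations are exactly the minimizers, so sublevel sets give their stability and the
gap gives attraction.

No other state is a local minimizer (`exists_energy_lt`). Flipping every second agent, possible on
an even ring, turns this into increasing the sum away from consensus. Small Möbius maps of the
sphere along `±t` times the three axes do so on average, to second order in `t`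
(`exists_perturbation`). A trajectory started at a perturbed state of lower energy must converge to
energies below the gap, so it leaves a neighbourhood of the original set (`not_isStable`). -/

/-! ### Algebra of the cross product. -/

lemma cross_ofLp_zero (x y : E3) : cross x y 0 = x 1 * y 2 - x 2 * y 1 := by
  simp [cross, cross_apply]

lemma cross_ofLp_one (x y : E3) : cross x y 1 = x 2 * y 0 - x 0 * y 2 := by
  simp [cross, cross_apply]

lemma cross_ofLp_two (x y : E3) : cross x y 2 = x 0 * y 1 - x 1 * y 0 := by
  simp [cross, cross_apply]

lemma inner_eq_coords (x y : E3) : inner ℝ x y = x 0 * y 0 + x 1 * y 1 + x 2 * y 2 := by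
  simp [PiLp.inner_apply, Fin.sum_univ_three, mul_comm]

lemma ext_coords {x y : E3} (h0 : x 0 = y 0) (h1 : x 1 = y 1) (h2 : x 2 = y 2) : x = y := by
  ext i
  fin_cases i <;> assumption

lemma cross_self_eq_zero (x : E3) : cross x x = 0 := by
  apply ext_coords <;> simp [cross_ofLp_zero, cross_ofLp_one, cross_ofLp_two, mul_comm]

lemma cross_zero (x : E3) : cross x 0 = 0 := by
  apply ext_coords <;> simp [cross_ofLp_zero, cross_ofLp_one, cross_ofLp_two]

lemma cross_add (x y z : E3) : cross x (y + z) = cross x y + cross x z := by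
  apply ext_coords <;> simp [cross_ofLp_zero, cross_ofLp_one, cross_ofLp_two] <;> ring

lemma cross_smul (x y : E3) (c : ℝ) : cross x (c • y) = c • cross x y := by
  apply ext_coords <;> simp [cross_ofLp_zero, cross_ofLp_one, cross_ofLp_two] <;> ring

lemma smul_cross (x y : E3) (c : ℝ) : cross (c • x) y = c • cross x y := by
  apply ext_coords <;> simp [cross_ofLp_zero, cross_ofLp_one, cross_ofLp_two] <;> ring

lemma cross_anticomm (x y : E3) : cross y x = -cross x y := by
  apply ext_coords <;> simp [cross_ofLp_zero, cross_ofLp_one, cross_ofLp_two] <;> ring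

lemma inner_self_cross (x y : E3) : inner ℝ x (cross x y) = 0 := by
  simp only [inner_eq_coords, cross_ofLp_zero, cross_ofLp_one, cross_ofLp_two]; ring

lemma inner_cross_self (x y : E3) : inner ℝ y (cross x y) = 0 := by
  simp only [inner_eq_coords, cross_ofLp_zero, cross_ofLp_one, cross_ofLp_two]; ring

lemma cross_cross_right (x y z : E3) :
    cross x (cross y z) = inner ℝ x z • y - inner ℝ x y • z := by
  apply ext_coords <;>
    simp [cross_ofLp_zero, cross_ofLp_one, cross_ofLp_two, inner_eq_coords] <;> ring

lemma inner_cross_cross (x y z w : E3) :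
    inner ℝ (cross x y) (cross z w)
      = inner ℝ x z * inner ℝ y w - inner ℝ x w * inner ℝ y z := by
  simp only [inner_eq_coords, cross_ofLp_zero, cross_ofLp_one, cross_ofLp_two]; ring

lemma inner_self_S2 (x : S2) : inner ℝ (x : E3) (x : E3) = 1 := by
  simp

lemma norm_S2 (x : S2) : ‖(x : E3)‖ = 1 := by simp

/-- On the plane orthogonal to a unit vector `x`, applying `x ×` twice is negation. -/
lemma eq_zero_of_cross_eq_zero {x w : E3} (hx : ‖x‖ = 1) (hw : inner ℝ x w = 0)
    (h : cross x w = 0) : w = 0 := by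
  have := cross_cross_right x x w
  rw [h, cross_zero, hw, real_inner_self_eq_norm_sq, hx] at this
  simpa using this.symm

/-- The weight of the two sides of the ring: `1` for `n ≥ 3` and `1 / 2` for `n = 2`, where both
neighbours of an agent coincide. -/
def edgeWeight (n : ℕ) : ℝ := if n = 2 then 1 / 2 else 1

lemma edgeWeight_pos (n : ℕ) : 0 < edgeWeight n := by
  unfold edgeWeight; split_ifs <;> norm_num

/-! ### The vector field, its equilibria and the energy. -/

section Ring

variable {n : ℕ} [NeZero n]

/-- For `n = 2` the right-hand side counts the single neighbour twice, which the weight `1 / 2`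
undoes; this makes the case uniform with `n ≥ 3`. -/
lemma sum_ringNeighbors (hn : 2 ≤ n) (f : Fin n → E3) (i : Fin n) :
    ∑ j ∈ ringNeighbors i, f j = edgeWeight n • (f (i - 1) + f (i + 1)) := by
  unfold ringNeighbors edgeWeight
  split_ifs with h
  · subst h
    have : i - 1 = i + 1 := by fin_cases i <;> rfl
    rw [this]
    simp only [Finset.pair_eq_singleton, Finset.sum_singleton]
    rw [← two_smul ℝ (f (i + 1)), smul_smul]; norm_num
  · have : i - 1 ≠ i + 1 := by
      intro h'
      have h2 : (1 : Fin n) + 1 = 0 := by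
        have : i + (1 + 1) = i + 0 := by
          rw [← add_assoc, ← h']; simp
        exact add_left_cancel this
      have h3 := congrArg Fin.val h2
      have h1 : ((1 : Fin n) : ℕ) = 1 := by
        rw [Fin.val_one']; exact Nat.mod_eq_of_lt (by omega)
      rw [Fin.val_add, h1, Fin.val_zero, Nat.mod_eq_of_lt (by omega)] at h3
      omega
    rw [Finset.sum_pair this, one_smul]

/-- The vector field on all of `(ℝ³)ⁿ`. -/
def ambientField (x : Fin n → E3) (i : Fin n) : E3 :=
  cross (x i) (∑ j ∈ ringNeighbors i, cross (x i) (x j))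

lemma closedLoopField_eq_ambientField (Γ : State n) (i : Fin n) :
    closedLoopField Γ i = ambientField (fun j => (Γ j : E3)) i := rfl

lemma closedLoopField_eq (hn : 2 ≤ n) (Γ : State n) (i : Fin n) :
    closedLoopField Γ i = edgeWeight n •
      cross (Γ i) (cross (Γ i) ((Γ (i - 1) : E3) + Γ (i + 1))) := by
  unfold closedLoopField
  rw [sum_ringNeighbors hn (fun j => cross (Γ i) (Γ j)), cross_smul, cross_add, cross_add, cross_add]

/-- The inner cross product is orthogonal to `Γ i`, where the outer `Γ i ×` is injective, so the
outer product can be dropped. -/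
theorem mem_equilibriumSet_iff (hn : 2 ≤ n) (Γ : State n) :
    Γ ∈ equilibriumSet n ↔
      ∀ i : Fin n, cross (Γ (i - 1)) (Γ i) = cross (Γ i) (Γ (i + 1)) := by
  refine forall_congr' fun i => ?_
  have key : cross (Γ i) ((Γ (i - 1) : E3) + Γ (i + 1)) = 0 ↔
      cross (Γ (i - 1)) (Γ i) = cross (Γ i) (Γ (i + 1)) := by
    rw [cross_add, cross_anticomm (Γ (i - 1)) (Γ i), neg_add_eq_zero]
  rw [← key, closedLoopField_eq hn]
  constructor
  · intro h
    exact eq_zero_of_cross_eq_zero (norm_S2 _) (inner_self_cross _ _)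
      ((smul_eq_zero.1 h).resolve_left (edgeWeight_pos n).ne')
  · intro h
    rw [h, cross_zero, smul_zero]

/-- The sum of the inner products of consecutive agents. -/
def energy (Γ : State n) : ℝ := ∑ i : Fin n, inner ℝ (Γ i : E3) (Γ (i + 1) : E3)

/-- The squared norm of the vector field. -/
def dissipation (Γ : State n) : ℝ := ∑ i : Fin n, ‖closedLoopField Γ i‖ ^ 2

lemma continuous_cross : Continuous fun p : E3 × E3 => cross p.1 p.2 := by
  unfold cross
  refine (PiLp.continuous_toLp 2 _).comp (continuous_pi fun i => ?_)
  simp only [cross_apply]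
  fin_cases i <;> simp <;> fun_prop

lemma continuous_cross_comp {X : Type*} [TopologicalSpace X] {f g : X → E3}
    (hf : Continuous f) (hg : Continuous g) : Continuous fun x => cross (f x) (g x) :=
  continuous_cross.comp (hf.prodMk hg)

lemma continuous_agent {m : ℕ} (i : Fin m) : Continuous fun Γ : State m => (Γ i : E3) :=
  continuous_subtype_val.comp (continuous_apply i)

lemma continuous_energy : Continuous (energy : State n → ℝ) :=
  continuous_finsetSum _ fun i _ => (continuous_agent i).inner (continuous_agent (i + 1))

lemma continuous_closedLoopField (i : Fin n) :
    Continuous fun Γ : State n => closedLoopField Γ i :=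
  continuous_cross_comp (continuous_agent i)
    (continuous_finsetSum _ fun j _ => continuous_cross_comp (continuous_agent i) (continuous_agent j))

lemma continuous_dissipation : Continuous (dissipation : State n → ℝ) :=
  continuous_finsetSum _ fun i _ => (continuous_closedLoopField i).norm.pow 2

lemma dissipation_nonneg (Γ : State n) : 0 ≤ dissipation Γ :=
  Finset.sum_nonneg fun _ _ => by positivity

lemma mem_equilibriumSet_iff_dissipation (Γ : State n) :
    Γ ∈ equilibriumSet n ↔ dissipation Γ = 0 := by
  unfold dissipation
  rw [Finset.sum_eq_zero_iff_of_nonneg (fun _ _ => by positivity)]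
  simp [equilibriumSet]

/-- With `s` the sum of the two neighbours, the field is `-edgeWeight n` times the tangential part
of `s`, and pairing that part with `s` gives its squared norm. -/
lemma inner_closedLoopField (hn : 2 ≤ n) (Γ : State n) (i : Fin n) :
    inner ℝ (closedLoopField Γ i) ((Γ (i - 1) : E3) + Γ (i + 1))
      = -(edgeWeight n)⁻¹ * ‖closedLoopField Γ i‖ ^ 2 := by
  have hw := (edgeWeight_pos n).ne'
  rw [closedLoopField_eq hn, norm_smul, mul_pow, inner_smul_left, Real.norm_eq_abs, sq_abs,
    ← real_inner_self_eq_norm_sq]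
  generalize (Γ (i - 1) : E3) + Γ (i + 1) = s
  have h1 : inner ℝ (cross (Γ i) (cross (Γ i) s)) s
      = - inner ℝ (cross (Γ i) (cross (Γ i) s)) (cross (Γ i) (cross (Γ i) s)) := by
    rw [inner_cross_cross, inner_self_S2, inner_self_cross]
    simp only [inner_eq_coords, cross_ofLp_zero, cross_ofLp_one, cross_ofLp_two]; ring
  rw [h1]
  simp
  field_simp

theorem hasDerivWithinAt_energy (hn : 2 ≤ n) {Γ : ℝ → State n} (hΓ : IsTrajectory Γ) {t : ℝ}
    (ht : 0 ≤ t) :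
    HasDerivWithinAt (fun s => energy (Γ s)) (-(edgeWeight n)⁻¹ * dissipation (Γ t)) (Ici 0) t := by
  have h := HasDerivWithinAt.fun_sum (u := Finset.univ)
    fun (i : Fin n) _ => (hΓ t ht i).inner ℝ (hΓ t ht (i + 1))
  refine h.congr_deriv ?_
  rw [Finset.sum_add_distrib]
  -- Shifting the index moves the derivative of the second factor of each edge to agent `i`, so that
  -- both neighbours of `i` appear.
  have h2 : ∑ i : Fin n, inner ℝ (Γ t i : E3) (closedLoopField (Γ t) (i + 1))
      = ∑ i : Fin n, inner ℝ (closedLoopField (Γ t) i) (Γ t (i - 1) : E3) := by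
    rw [← Equiv.sum_comp (Equiv.addRight (1 : Fin n))
      (fun i => inner ℝ (closedLoopField (Γ t) i) (Γ t (i - 1) : E3))]
    refine Finset.sum_congr rfl fun i _ => ?_
    simp [real_inner_comm]
  rw [h2, ← Finset.sum_add_distrib, dissipation, Finset.mul_sum]
  refine Finset.sum_congr rfl fun i _ => ?_
  rw [← inner_closedLoopField hn, inner_add_right, add_comm]

end Ring

/-! ### Global existence for bounded Lipschitz fields. -/

section GlobalExistence

variable {E : Type*} [NormedAddCommGroup E] [NormedSpace ℝ E] [CompleteSpace E]

open NNReal in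
/-- A bounded Lipschitz vector field has a global integral curve through every point. -/
theorem exists_global_integralCurve {v : E → E} {K L : ℝ≥0} (hv : LipschitzWith K v)
    (hL : ∀ x, ‖v x‖ ≤ L) (x₀ : E) :
    ∃ α : ℝ → E, α 0 = x₀ ∧ ∀ t, HasDerivAt α (v (α t)) t := by
  have hloc : ∀ a : ℝ, 0 < a → ∃ α : ℝ → E, α 0 = x₀ ∧
      ∀ t ∈ Ioo (-a) a, HasDerivAt α (v (α t)) t := by
    intro a ha
    have hpl : IsPicardLindelof (fun _ => v) (tmin := -a) (tmax := a)
        ⟨0, mem_Icc.2 ⟨by linarith, ha.le⟩⟩ x₀ (L * a.toNNReal) 0 L K :=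
      IsPicardLindelof.of_time_independent (fun x _ => hL x) hv.lipschitzOnWith
        (by simp [ha.le])
    obtain ⟨α, h0, hα⟩ := hpl.exists_eq_forall_mem_Icc_hasDerivWithinAt₀
    exact ⟨α, h0, fun t ht => (hα t (Ioo_subset_Icc_self ht)).hasDerivAt (Icc_mem_nhds ht.1 ht.2)⟩
  choose! γ hγ0 hγ using hloc
  have huniq : ∀ a b : ℝ, 0 < a → a ≤ b → EqOn (γ a) (γ b) (Ioo (-a) a) := by
    intro a b ha hab
    refine ODE_solution_unique_of_mem_Ioo (v := fun _ => v) (s := fun _ => univ) (K := K)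
      (t₀ := 0) (fun t _ => hv.lipschitzOnWith) ⟨by linarith, ha⟩
      (fun t ht => ⟨hγ a ha t ht, mem_univ _⟩)
      (fun t ht => ⟨hγ b (ha.trans_le hab) t ⟨by linarith [ht.1], by linarith [ht.2]⟩,
        mem_univ _⟩) ?_
    rw [hγ0 a ha, hγ0 b (ha.trans_le hab)]
  -- At time `t` the solution on the interval of radius `|t| + 1` is used; by uniqueness these agree
  -- wherever they overlap.
  refine ⟨fun t => γ (|t| + 1) t, hγ0 _ (by positivity), fun t => ?_⟩
  have htb : t ∈ Ioo (-(|t| + 1)) (|t| + 1) := by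
    constructor <;> linarith [neg_abs_le t, le_abs_self t]
  refine (hγ (|t| + 1) (by positivity) t htb).congr_of_eventuallyEq ?_
  filter_upwards [isOpen_Ioo.mem_nhds htb] with s hs
  rcases le_total (|s|) (|t|) with h | h
  · exact huniq _ _ (by positivity) (by linarith)
      ⟨by linarith [neg_abs_le s], by linarith [le_abs_self s]⟩
  · exact (huniq _ _ (by positivity) (by linarith) hs).symm

end GlobalExistence

/-! ### Trajectories, energy decay and LaSalle's principle. -/

section Trajectories

variable {n : ℕ} [NeZero n]

lemma contDiff_cross {X : Type*} [NormedAddCommGroup X] [NormedSpace ℝ X] {f g : X → E3}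
    (hf : ContDiff ℝ 1 f) (hg : ContDiff ℝ 1 g) : ContDiff ℝ 1 fun x => cross (f x) (g x) := by
  have hf' := contDiff_euclidean.1 hf
  have hg' := contDiff_euclidean.1 hg
  rw [contDiff_euclidean]
  intro i
  fin_cases i
  · simp only [Fin.zero_eta, cross_ofLp_zero]
    exact ((hf' 1).mul (hg' 2)).sub ((hf' 2).mul (hg' 1))
  · simp only [Fin.mk_one, cross_ofLp_one]
    exact ((hf' 2).mul (hg' 0)).sub ((hf' 0).mul (hg' 2))
  · simp only [Fin.reduceFinMk, cross_ofLp_two]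
    exact ((hf' 0).mul (hg' 1)).sub ((hf' 1).mul (hg' 0))

lemma contDiff_ambientField : ContDiff ℝ 1 (ambientField (n := n)) := by
  rw [contDiff_pi]
  intro i
  unfold ambientField
  exact contDiff_cross (contDiff_apply ℝ E3 i) (ContDiff.sum fun j _ =>
    contDiff_cross (contDiff_apply ℝ E3 i) (contDiff_apply ℝ E3 j))

/-- Every state is the initial state of a trajectory. -/
theorem exists_trajectory (Γ₀ : State n) : ∃ Γ : ℝ → State n, IsTrajectory Γ ∧ Γ 0 = Γ₀ := by
  -- The product of spheres lies in the unit ball of the sup norm, where the cutoff is `1`; the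
  -- truncated field is compactly supported and `C¹`, hence Lipschitz and bounded.
  let χ : ContDiffBump (0 : Fin n → E3) := ⟨2, 3, by norm_num, by norm_num⟩
  let v : (Fin n → E3) → (Fin n → E3) := fun x => χ x • ambientField x
  have hv : ContDiff ℝ 1 v := χ.contDiff.smul contDiff_ambientField
  have hc : HasCompactSupport v := χ.hasCompactSupport.smul_right
  obtain ⟨K, hK⟩ := hv.lipschitzWith_of_hasCompactSupport hc one_ne_zero
  obtain ⟨C, hC⟩ := hc.exists_bound_of_continuous hv.continuous
  obtain ⟨α, h0, hα⟩ := exists_global_integralCurve (L := C.toNNReal) hK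
    (fun x => (hC x).trans (Real.le_coe_toNNReal C)) (fun i => (Γ₀ i : E3))
  have hαi : ∀ i t, HasDerivAt (fun s => α s i) (v (α t) i) t :=
    fun i t => hasDerivAt_pi.1 (hα t) i
  -- The cutoff only rescales the field, so each component stays orthogonal to `x i` and norms are
  -- conserved.
  have hnorm : ∀ i t, ‖α t i‖ = 1 := by
    intro i t
    have hconst : ∀ s, HasDerivAt (fun s => inner ℝ (α s i) (α s i)) 0 s := by
      intro s
      refine ((hαi i s).inner ℝ (hαi i s)).congr_deriv ?_
      rw [real_inner_comm]
      simp [v, ambientField, inner_smul_left, real_inner_comm, inner_self_cross]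
    have h := is_const_of_deriv_eq_zero (fun s => (hconst s).differentiableAt)
      (fun s => (hconst s).deriv) t 0
    simp only [h0, real_inner_self_eq_norm_sq] at h
    exact (pow_eq_one_iff_of_nonneg (norm_nonneg _) two_ne_zero).1 (by simpa using h)
  refine ⟨fun t i => ⟨α t i, by simp [hnorm]⟩, ?_, ?_⟩
  · intro t _ i
    have hχ : χ (α t) = 1 := by
      apply χ.one_of_mem_closedBall
      rw [mem_closedBall_zero_iff]
      refine (pi_norm_le_iff_of_nonneg (by norm_num [χ])).2 fun j => ?_
      rw [hnorm]; norm_num [χ]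
    refine ((hαi i t).congr_deriv ?_).hasDerivWithinAt
    simp [v, hχ, closedLoopField_eq_ambientField]
  · funext i
    apply Subtype.ext
    simp [h0]

lemma IsTrajectory.continuousOn {Γ : ℝ → State n} (hΓ : IsTrajectory Γ) :
    ContinuousOn Γ (Ici 0) := by
  refine continuousOn_pi.2 fun i => ?_
  exact Topology.IsInducing.subtypeVal.continuousOn_iff.2
    fun t ht => (hΓ t ht i).continuousWithinAt

theorem antitoneOn_energy (hn : 2 ≤ n) {Γ : ℝ → State n} (hΓ : IsTrajectory Γ) :
    AntitoneOn (fun t => energy (Γ t)) (Ici 0) := by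
  refine antitoneOn_of_hasDerivWithinAt_nonpos (convex_Ici 0)
    (continuous_energy.comp_continuousOn hΓ.continuousOn)
    (f' := fun t => -(edgeWeight n)⁻¹ * dissipation (Γ t)) (fun t ht => ?_) (fun t ht => ?_)
  · exact (hasDerivWithinAt_energy hn hΓ (interior_subset ht)).mono interior_subset
  · have := mul_nonneg (inv_pos.2 (edgeWeight_pos n)).le (dissipation_nonneg (Γ t))
    linarith

lemma exists_tendsto_energy (hn : 2 ≤ n) {Γ : ℝ → State n} (hΓ : IsTrajectory Γ) :
    ∃ v, Tendsto (fun t => energy (Γ t)) atTop (𝓝 v) ∧ ∀ t, 0 ≤ t → v ≤ energy (Γ t) := by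
  obtain ⟨B, hB⟩ := (isCompact_range (continuous_energy (n := n))).bddBelow
  -- Replacing `t` by `max t 0` freezes negative times, giving a monotone function on all of `ℝ`.
  have hanti : Antitone (fun t : ℝ => energy (Γ (max t 0))) := fun a b hab =>
    antitoneOn_energy hn hΓ (mem_Ici.2 (le_max_right _ _)) (mem_Ici.2 (le_max_right _ _))
      (max_le_max_right 0 hab)
  have hbdd : BddBelow (range fun t : ℝ => energy (Γ (max t 0))) :=
    ⟨B, by rintro _ ⟨t, rfl⟩; exact hB ⟨_, rfl⟩⟩
  refine ⟨_, (tendsto_atTop_ciInf hanti hbdd).congr' ?_, fun t ht => ?_⟩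
  · filter_upwards [eventually_ge_atTop 0] with t ht
    rw [max_eq_left ht]
  · exact (ciInf_le hbdd t).trans_eq (by rw [max_eq_left ht])

lemma exists_dist_le_of_trajectory :
    ∃ L : ℝ, 0 < L ∧ ∀ Γ : ℝ → State n, IsTrajectory Γ → ∀ s t : ℝ, 0 ≤ s → s ≤ t →
      dist (Γ t) (Γ s) ≤ L * (t - s) := by
  have hb : ∃ C, ∀ (i : Fin n) (Γ : State n), ‖closedLoopField Γ i‖ ≤ C := by
    have : ∀ i : Fin n, ∃ C, ∀ Γ : State n, ‖closedLoopField Γ i‖ ≤ C := fun i => by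
      obtain ⟨C, hC⟩ := isCompact_univ.exists_bound_of_continuousOn
        (continuous_closedLoopField (n := n) i).continuousOn
      exact ⟨C, fun Γ => hC Γ (mem_univ _)⟩
    choose C hC using this
    refine ⟨∑ i, |C i|, fun i Γ => (hC i Γ).trans ((le_abs_self _).trans ?_)⟩
    exact Finset.single_le_sum (f := fun i => |C i|) (fun _ _ => abs_nonneg _)
      (Finset.mem_univ i)
  obtain ⟨C, hC⟩ := hb
  refine ⟨|C| + 1, by positivity, fun Γ hΓ s t hs hst => ?_⟩
  refine (dist_pi_le_iff (by have := sub_nonneg.2 hst; positivity)).2 fun i => ?_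
  rw [Subtype.dist_eq, dist_eq_norm]
  have := (convex_Ici (0 : ℝ)).norm_image_sub_le_of_norm_hasDerivWithin_le
    (fun x hx => hΓ x hx i) (C := |C| + 1)
    (fun x _ => (hC i _).trans (by linarith [le_abs_self C])) hs (hs.trans hst)
  rwa [Real.norm_of_nonneg (sub_nonneg.2 hst)] at this

/-- **LaSalle's invariance principle**: limit points of trajectories are equilibria. -/
theorem mem_equilibriumSet_of_mapClusterPt (hn : 2 ≤ n) {Γ : ℝ → State n} (hΓ : IsTrajectory Γ)
    {p : State n} (hp : MapClusterPt p atTop Γ) : p ∈ equilibriumSet n := by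
  rw [mem_equilibriumSet_iff_dissipation]
  by_contra hne
  have hpos : 0 < dissipation p := lt_of_le_of_ne (dissipation_nonneg p) (Ne.symm hne)
  obtain ⟨m, hm, hmp⟩ := exists_between hpos
  obtain ⟨r, hr, hball⟩ := Metric.mem_nhds_iff.1
    (continuous_dissipation.continuousAt.preimage_mem_nhds (Ioi_mem_nhds hmp))
  obtain ⟨L, hL, hlip⟩ := exists_dist_le_of_trajectory (n := n)
  obtain ⟨v, hv, -⟩ := exists_tendsto_energy hn hΓ
  -- In time `τ` a trajectory moves at most `r / 2`, so one that starts within `r / 2` of `p` stays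
  -- in the ball where the dissipation exceeds `m`. Each such visit costs a fixed amount of energy,
  -- and visits occur at arbitrarily late times, although the energy converges.
  set τ := r / 2 / L with hτ
  have hτpos : 0 < τ := by positivity
  have hw := inv_pos.2 (edgeWeight_pos n)
  have hdrop : Tendsto (fun t => energy (Γ (t + τ)) - energy (Γ t)) atTop (𝓝 (v - v)) :=
    (hv.comp (tendsto_atTop_add_const_right _ τ tendsto_id)).sub hv
  rw [sub_self] at hdrop
  have hlt : -(edgeWeight n)⁻¹ * m * τ < 0 := by
    have : 0 < (edgeWeight n)⁻¹ * m * τ := by positivity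
    linarith
  have hev := (hdrop.eventually (lt_mem_nhds hlt)).and (eventually_ge_atTop 0)
  have hfreq := (hp.frequently (Metric.ball_mem_nhds p (half_pos hr))).and_eventually hev
  obtain ⟨t, htp, htd, ht0⟩ := hfreq.exists
  have hin : ∀ s ∈ Icc t (t + τ), m < dissipation (Γ s) := by
    intro s hs
    apply hball
    rw [Metric.mem_ball]
    have h1 := hlip Γ hΓ t s ht0 hs.1
    have h2 : L * (s - t) ≤ r / 2 := by
      calc L * (s - t) ≤ L * τ := by gcongr; linarith [hs.2]
        _ = r / 2 := by rw [hτ]; field_simp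
    calc dist (Γ s) p ≤ dist (Γ s) (Γ t) + dist (Γ t) p := dist_triangle _ _ _
      _ < r / 2 + r / 2 := add_lt_add_of_le_of_lt (h1.trans h2) htp
      _ = r := by ring
  have hanti : AntitoneOn (fun s => energy (Γ s) + (edgeWeight n)⁻¹ * m * s) (Icc t (t + τ)) := by
    have hsub : Icc t (t + τ) ⊆ Ici 0 := fun s hs => ht0.trans hs.1
    refine antitoneOn_of_hasDerivWithinAt_nonpos (convex_Icc _ _)
      (((continuous_energy.comp_continuousOn hΓ.continuousOn).mono hsub).add (by fun_prop))
      (f' := fun s => -(edgeWeight n)⁻¹ * dissipation (Γ s) + (edgeWeight n)⁻¹ * m)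
      (fun s hs => ?_) (fun s hs => ?_)
    · have hs' := interior_subset hs
      refine ((hasDerivWithinAt_energy hn hΓ (hsub hs')).mono
        (interior_subset.trans hsub)).add ?_
      simpa using ((hasDerivAt_id s).const_mul ((edgeWeight n)⁻¹ * m)).hasDerivWithinAt
    · have := mul_lt_mul_of_pos_left (hin s (interior_subset hs)) hw
      linarith
  have := hanti (left_mem_Icc.2 (by linarith)) (right_mem_Icc.2 (by linarith)) (by linarith)
  simp only at this
  linarith

end Trajectories

/-- A decreasing intersection of compact connected sets is connected. -/
theorem isPreconnected_iInter_of_antitone {X : Type*} [TopologicalSpace X] [T2Space X]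
    {K : ℕ → Set X} (hK : Antitone K) (hc : ∀ m, IsCompact (K m))
    (hp : ∀ m, IsPreconnected (K m)) : IsPreconnected (⋂ m, K m) := by
  have hdir : Directed (· ⊇ ·) K := hK.directed_ge
  have hcompact : IsCompact (⋂ m, K m) :=
    (hc 0).of_isClosed_subset (isClosed_iInter fun m => (hc m).isClosed) (iInter_subset K 0)
  rw [isPreconnected_iff_subset_of_disjoint_closed]
  intro A B hA hB hsub hdisj
  have hA' := hcompact.inter_right hA
  have hB' := hcompact.inter_right hB
  have hAB : Disjoint ((⋂ m, K m) ∩ A) ((⋂ m, K m) ∩ B) := by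
    rw [disjoint_iff_inter_eq_empty, ← inter_inter_distrib_left, hdisj]
  obtain ⟨U, V, hU, hV, hAU, hBV, hUV⟩ := SeparatedNhds.of_isCompact_isCompact hA' hB' hAB
  obtain ⟨m, hm⟩ := exists_subset_nhds_of_isCompact hdir hc (U := U ∪ V) fun x hx =>
    (hU.union hV).mem_nhds ((hsub hx).imp (fun h => hAU ⟨hx, h⟩) (fun h => hBV ⟨hx, h⟩))
  rcases (hp m).subset_or_subset hU hV hUV hm with h | h
  · left
    intro x hx
    refine (hsub hx).resolve_right fun hxB => ?_
    exact disjoint_left.1 hUV (h (iInter_subset K m hx)) (hBV ⟨hx, hxB⟩)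
  · right
    intro x hx
    refine (hsub hx).resolve_left fun hxA => ?_
    exact disjoint_left.1 hUV (hAU ⟨hx, hxA⟩) (h (iInter_subset K m hx))

/-! ### Comparison of the geodesic and the chordal metrics. -/

lemma dist_eq_two_mul_sin (x y : S2) : dist x y = 2 * Real.sin (geoDist x y / 2) := by
  have h0 : 0 ≤ geoDist x y := Real.arccos_nonneg _
  have hpi : geoDist x y ≤ Real.pi := Real.arccos_le_pi _
  have hsin : 0 ≤ Real.sin (geoDist x y / 2) :=
    Real.sin_nonneg_of_nonneg_of_le_pi (by linarith) (by linarith)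
  have habs := abs_real_inner_le_norm (x : E3) (y : E3)
  rw [norm_S2, norm_S2, one_mul, abs_le] at habs
  have hcos : Real.cos (geoDist x y) = inner ℝ (x : E3) (y : E3) :=
    Real.cos_arccos habs.1 habs.2
  rw [← sq_eq_sq₀ dist_nonneg (by positivity), Subtype.dist_eq, dist_eq_norm,
    norm_sub_sq_real, norm_S2, norm_S2, ← hcos, mul_pow, Real.sin_sq_eq_half_sub,
    mul_div_cancel₀ _ (two_ne_zero)]
  ring

lemma dist_le_geoDist (x y : S2) : dist x y ≤ geoDist x y := by
  rw [dist_eq_two_mul_sin]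
  have := Real.sin_le (x := geoDist x y / 2) (div_nonneg (Real.arccos_nonneg _) two_pos.le)
  linarith

lemma geoDist_le (x y : S2) : geoDist x y ≤ Real.pi / 2 * dist x y := by
  have h0 : 0 ≤ geoDist x y := Real.arccos_nonneg _
  have hpi : geoDist x y ≤ Real.pi := Real.arccos_le_pi _
  rw [dist_eq_two_mul_sin]
  have := Real.mul_le_sin (x := geoDist x y / 2) (by linarith) (by linarith)
  have hp := Real.pi_pos
  calc geoDist x y = Real.pi * (2 / Real.pi * (geoDist x y / 2)) := by field_simp
    _ ≤ Real.pi * Real.sin (geoDist x y / 2) := by gcongr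
    _ = _ := by ring

lemma stateDist_nonneg {n : ℕ} (Γ Γ' : State n) : 0 ≤ stateDist Γ Γ' :=
  Real.iSup_nonneg fun _ => Real.arccos_nonneg _

lemma dist_le_stateDist {n : ℕ} (Γ Γ' : State n) : dist Γ Γ' ≤ stateDist Γ Γ' :=
  (dist_pi_le_iff (stateDist_nonneg Γ Γ')).2 fun i => (dist_le_geoDist _ _).trans
    (le_ciSup (f := fun i => geoDist (Γ i) (Γ' i)) (finite_range _).bddAbove i)

lemma stateDist_le {n : ℕ} (Γ Γ' : State n) : stateDist Γ Γ' ≤ Real.pi / 2 * dist Γ Γ' :=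
  Real.iSup_le (fun i => (geoDist_le _ _).trans
    (mul_le_mul_of_nonneg_left (dist_le_pi_dist Γ Γ' i) (by positivity))) (by positivity)

lemma distTo_nonneg {n : ℕ} (M : Set (State n)) (Γ : State n) : 0 ≤ distTo M Γ :=
  Real.iInf_nonneg fun _ => stateDist_nonneg _ _

lemma distTo_le {n : ℕ} {M : Set (State n)} {Γ' : State n} (h : Γ' ∈ M) (Γ : State n) :
    distTo M Γ ≤ Real.pi / 2 * dist Γ Γ' :=
  (ciInf_le (f := fun p : M => stateDist Γ (p : State n))
    ⟨0, by rintro _ ⟨p, rfl⟩; exact stateDist_nonneg _ _⟩ ⟨Γ', h⟩).trans (stateDist_le _ _)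

lemma exists_dist_lt_of_distTo_lt {n : ℕ} {M : Set (State n)} (hM : M.Nonempty) {Γ : State n}
    {r : ℝ} (h : distTo M Γ < r) : ∃ Γ' ∈ M, dist Γ Γ' < r := by
  have := hM.to_subtype
  obtain ⟨p, hp⟩ := exists_lt_of_ciInf_lt h
  exact ⟨p, p.2, (dist_le_stateDist _ _).trans_lt hp⟩

/-! ### Limit sets and convergence to one component. -/

section LimitSet

variable {n : ℕ} [NeZero n]

/-- The set of limit points of a curve in the state space. -/
def limitSet {n : ℕ} (Γ : ℝ → State n) : Set (State n) :=
  ⋂ m : ℕ, closure (Γ '' Ici (m : ℝ))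

lemma antitone_closure_image {n : ℕ} (Γ : ℝ → State n) :
    Antitone fun m : ℕ => closure (Γ '' Ici (m : ℝ)) := fun _ _ h =>
  closure_mono (image_mono (Ici_subset_Ici.2 (Nat.cast_le.2 h)))

lemma mapClusterPt_of_mem_limitSet {n : ℕ} {Γ : ℝ → State n} {p : State n}
    (hp : p ∈ limitSet Γ) : MapClusterPt p atTop Γ := by
  rw [mapClusterPt_iff_frequently]
  intro s hs
  rw [frequently_atTop]
  intro a
  obtain ⟨m, hm⟩ := exists_nat_ge a
  obtain ⟨_, hqs, t, ht, rfl⟩ := mem_closure_iff_nhds.1 (mem_iInter.1 hp m) s hs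
  exact ⟨t, hm.trans ht, hqs⟩

lemma limitSet_nonempty {n : ℕ} (Γ : ℝ → State n) : (limitSet Γ).Nonempty :=
  IsCompact.nonempty_iInter_of_directed_nonempty_isCompact_isClosed _
    (antitone_closure_image Γ).directed_ge (fun _ => (nonempty_Ici.image Γ).closure)
    (fun _ => isClosed_closure.isCompact) (fun _ => isClosed_closure)

lemma eventually_mem_of_limitSet_subset {n : ℕ} {Γ : ℝ → State n} {U : Set (State n)}
    (hU : IsOpen U) (h : limitSet Γ ⊆ U) : ∀ᶠ t in atTop, Γ t ∈ U := by
  obtain ⟨m, hm⟩ := exists_subset_nhds_of_isCompact (antitone_closure_image Γ).directed_ge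
    (fun _ => isClosed_closure.isCompact) (U := U) fun x hx => hU.mem_nhds (h hx)
  filter_upwards [eventually_ge_atTop (m : ℝ)] with t ht
  exact hm (subset_closure ⟨t, ht, rfl⟩)

/-- By compactness of the state space a curve eventually enters every neighbourhood of its limit
set. -/
lemma approaches_of_limitSet_subset {n : ℕ} {Γ : ℝ → State n} {M : Set (State n)}
    (h : limitSet Γ ⊆ M) : Approaches Γ M := by
  refine Metric.tendsto_nhds.2 fun ε hε => ?_
  have hpi := Real.pi_pos
  have hsub : limitSet Γ ⊆ Metric.thickening (ε / (Real.pi / 2)) (limitSet Γ) :=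
    Metric.self_subset_thickening (by positivity) _
  filter_upwards [eventually_mem_of_limitSet_subset Metric.isOpen_thickening hsub] with t ht
  obtain ⟨z, hz, hd⟩ := Metric.mem_thickening_iff.1 ht
  rw [Real.dist_0_eq_abs, abs_of_nonneg (distTo_nonneg _ _)]
  refine (distTo_le (h hz) _).trans_lt ?_
  rw [lt_div_iff₀ (by positivity)] at hd
  linarith

lemma limitSet_subset_equilibriumSet (hn : 2 ≤ n) {Γ : ℝ → State n} (hΓ : IsTrajectory Γ) :
    limitSet Γ ⊆ equilibriumSet n := fun _ hp =>
  mem_equilibriumSet_of_mapClusterPt hn hΓ (mapClusterPt_of_mem_limitSet hp)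

lemma isPreconnected_limitSet {Γ : ℝ → State n} (hΓ : IsTrajectory Γ) :
    IsPreconnected (limitSet Γ) := by
  refine isPreconnected_iInter_of_antitone (antitone_closure_image Γ)
    (fun _ => isClosed_closure.isCompact) fun m => ?_
  exact (isPreconnected_Ici.image Γ (hΓ.continuousOn.mono
    (Ici_subset_Ici.2 (Nat.cast_nonneg m)))).closure

lemma energy_eq_of_mem_limitSet {Γ : ℝ → State n} {v : ℝ}
    (hv : Tendsto (fun t => energy (Γ t)) atTop (𝓝 v)) {p : State n} (hp : p ∈ limitSet Γ) :
    energy p = v := by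
  have h1 : MapClusterPt (energy p) atTop (energy ∘ Γ) :=
    (mapClusterPt_of_mem_limitSet hp).continuousAt_comp continuous_energy.continuousAt
  have h2 : ClusterPt (energy p) (𝓝 v) := ClusterPt.mono h1 hv
  exact eq_of_nhds_neBot h2

theorem exists_approaches_equilibriumManifold (hn : 2 ≤ n) {Γ : ℝ → State n}
    (hΓ : IsTrajectory Γ) : ∃ C, IsEquilibriumManifold C ∧ Approaches Γ C := by
  obtain ⟨p, hp⟩ := limitSet_nonempty Γ
  have hsub := limitSet_subset_equilibriumSet hn hΓ
  exact ⟨_, ⟨p, hsub hp, rfl⟩, approaches_of_limitSet_subset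
    ((isPreconnected_limitSet hΓ).subset_connectedComponentIn hp hsub)⟩

end LimitSet

/-! ### Finiteness of the energy values at equilibria. -/

section EnergyValues

variable {n : ℕ} [NeZero n]

lemma ofNat_add_one (m : ℕ) : Fin.ofNat n (m + 1) = Fin.ofNat n m + 1 := by
  apply Fin.ext
  simp [Fin.ofNat, Fin.val_add]

lemma sum_range_ofNat (f : Fin n → ℝ) : ∑ m ∈ Finset.range n, f (Fin.ofNat n m) = ∑ i, f i := by
  rw [← Fin.sum_univ_eq_sum_range (fun m => f (Fin.ofNat n m))]
  refine Finset.sum_congr rfl fun i _ => ?_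
  congr 1
  exact Fin.ext (Nat.mod_eq_of_lt i.2)

lemma apply_eq_of_succ_eq {α : Type*} {f : Fin n → α} (h : ∀ i, f (i + 1) = f i) (i : Fin n) :
    f i = f 0 := by
  have key : ∀ m, f (Fin.ofNat n m) = f (Fin.ofNat n 0) := by
    intro m
    induction m with
    | zero => rfl
    | succ m ih => rw [ofNat_add_one, h, ih]
  have := key i
  rwa [show Fin.ofNat n i = i from Fin.ext (Nat.mod_eq_of_lt i.2),
    show Fin.ofNat n 0 = 0 from Fin.ext (by simp)] at this

/-- A sequence of numbers `±c`, where `u = c + s i` lies on the unit circle, together with the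
products of the corresponding rotations. -/
lemma exists_sum_prod_eq {c s : ℝ} {d : ℕ → ℝ} (hd : ∀ m, d m = c ∨ d m = -c) (m : ℕ) :
    ∃ a b : ℕ, a + b = m ∧ ∑ j ∈ Finset.range m, d j = ((a : ℝ) - b) * c ∧
      ∏ j ∈ Finset.range m, (⟨d j, s⟩ : ℂ)
        = (⟨c, s⟩ : ℂ) ^ a * (-(starRingEnd ℂ ⟨c, s⟩)) ^ b := by
  induction m with
  | zero => exact ⟨0, 0, rfl, by simp, by simp⟩
  | succ m ih =>
    obtain ⟨a, b, hab, hsum, hprod⟩ := ih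
    rcases hd m with h | h
    · refine ⟨a + 1, b, by omega, ?_, ?_⟩
      · rw [Finset.sum_range_succ, hsum, h]; push_cast; ring
      · rw [Finset.prod_range_succ, hprod, h]; ring
    · refine ⟨a, b + 1, by omega, ?_, ?_⟩
      · rw [Finset.sum_range_succ, hsum, h]; push_cast; ring
      · rw [Finset.prod_range_succ, hprod, h,
          show (⟨-c, s⟩ : ℂ) = -(starRingEnd ℂ ⟨c, s⟩) by apply Complex.ext <;> simp]
        ring

/-- Squaring removes the sign, and the conjugate of `u` is its inverse, so `u ^ (2 * |a - b|) = 1`.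
As `|a - b|` divides `N!`, the final exponent does not depend on `a` and `b`. -/
lemma pow_eq_one_of_mul_eq_one {u : ℂ} (hu : u * starRingEnd ℂ u = 1) {a b N : ℕ} (hab : a ≠ b)
    (h : u ^ a * (-(starRingEnd ℂ u)) ^ b = 1) (ha : a ≤ N) (hb : b ≤ N) :
    u ^ (2 * N.factorial) = 1 := by
  have key : ∀ (z : ℂ) (k : ℕ), 0 < k → k ≤ N → z ^ (2 * k) = 1 → z ^ (2 * N.factorial) = 1 := by
    intro z k hk hkN hz
    obtain ⟨q, hq⟩ := Nat.dvd_factorial hk hkN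
    rw [hq, ← mul_assoc, pow_mul, hz, one_pow]
  have hsq : (u ^ 2) ^ a * (starRingEnd ℂ u ^ 2) ^ b = 1 := by
    have h2 : (u ^ a * (-(starRingEnd ℂ u)) ^ b) ^ 2 = 1 := by rw [h, one_pow]
    rw [← h2, mul_pow, ← pow_mul, ← pow_mul, ← pow_mul, ← pow_mul, mul_comm 2 a, mul_comm b 2,
      (even_two_mul b).neg_pow]
  have hu2 : u ^ 2 * starRingEnd ℂ u ^ 2 = 1 := by rw [← mul_pow, hu, one_pow]
  rcases lt_or_gt_of_ne hab with hlt | hlt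
  · obtain ⟨k, rfl⟩ := Nat.exists_eq_add_of_lt hlt
    have h3 : starRingEnd ℂ u ^ (2 * (k + 1)) = 1 := by
      rw [pow_mul]
      calc _ = (u ^ 2 * starRingEnd ℂ u ^ 2) ^ a * (starRingEnd ℂ u ^ 2) ^ (k + 1) := by
            rw [hu2, one_pow, one_mul]
        _ = (u ^ 2) ^ a * (starRingEnd ℂ u ^ 2) ^ (a + k + 1) := by ring
        _ = 1 := hsq
    have h4 := congrArg (starRingEnd ℂ) (key _ (k + 1) (by omega) (by omega) h3)
    simpa using h4
  · obtain ⟨k, rfl⟩ := Nat.exists_eq_add_of_lt hlt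
    refine key u (k + 1) (by omega) (by omega) ?_
    rw [pow_mul]
    calc _ = (u ^ 2 * starRingEnd ℂ u ^ 2) ^ b * (u ^ 2) ^ (k + 1) := by
          rw [hu2, one_pow, one_mul]
      _ = (u ^ 2) ^ (b + k + 1) * (starRingEnd ℂ u ^ 2) ^ b := by ring
      _ = 1 := hsq

/-- Consecutive rotations in a plane compose like complex numbers. -/
lemma eq_smul_add_smul_cross {g : ℕ → E3} {d : ℕ → ℝ} {e : E3} {s : ℝ}
    (he : ‖e‖ = 1) (h0 : inner ℝ e (g 0) = 0)
    (hg : ∀ m, g (m + 1) = d m • g m + s • cross e (g m)) (m : ℕ) :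
    g m = (∏ j ∈ Finset.range m, (⟨d j, s⟩ : ℂ)).re • g 0
      + (∏ j ∈ Finset.range m, (⟨d j, s⟩ : ℂ)).im • cross e (g 0) := by
  induction m with
  | zero => simp
  | succ m ih =>
    have hee : cross e (cross e (g 0)) = -g 0 := by
      rw [cross_cross_right, h0, real_inner_self_eq_norm_sq, he]; simp
    rw [Finset.prod_range_succ, hg, Complex.mul_re, Complex.mul_im]
    nth_rewrite 1 2 [ih]
    rw [cross_add, cross_smul, cross_smul, hee]
    module

lemma prod_eq_one_of_rotation {g : ℕ → E3} {d : ℕ → ℝ} {e : E3} {s : ℝ} {N : ℕ}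
    (he : ‖e‖ = 1) (hg0 : ‖g 0‖ = 1) (h0 : inner ℝ e (g 0) = 0)
    (hg : ∀ m, g (m + 1) = d m • g m + s • cross e (g m)) (hN : g N = g 0) :
    ∏ j ∈ Finset.range N, (⟨d j, s⟩ : ℂ) = 1 := by
  have h := eq_smul_add_smul_cross he h0 hg N
  rw [hN] at h
  set p := ∏ j ∈ Finset.range N, (⟨d j, s⟩ : ℂ)
  apply Complex.ext
  · have h1 := congrArg (fun x => inner ℝ (g 0) x) h
    simp only [inner_add_right, inner_smul_right, inner_cross_self, real_inner_self_eq_norm_sq,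
      hg0] at h1
    simp only [Complex.one_re]
    linarith
  · have hJ : inner ℝ (cross e (g 0)) (cross e (g 0)) = 1 := by
      rw [inner_cross_cross, h0, real_inner_self_eq_norm_sq, real_inner_self_eq_norm_sq, he, hg0]
      norm_num
    have h1 := congrArg (fun x => inner ℝ (cross e (g 0)) x) h
    simp only [inner_add_right, inner_smul_right, hJ,
      real_inner_comm (g 0) (cross e (g 0)), inner_cross_self] at h1
    simp only [Complex.one_im]
    linarith

/-- All steps share the sine `s`, so their cosines are `±c`: each step multiplies by `c + s i` or
`-c + s i` in the plane orthogonal to `w`. The closing condition makes `c + s i` a root of unity. -/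
lemma exists_energy_eq {Γ : State n} (hΓ : ∀ i : Fin n,
      cross (Γ (i - 1)) (Γ i) = cross (Γ i) (Γ (i + 1))) :
    ∃ a ≤ n, ∃ b ≤ n, ∃ u : ℂ, u ^ (2 * n.factorial) = 1 ∧
      energy Γ = ((a : ℝ) - b) * u.re := by
  set w := cross (Γ 0) (Γ (0 + 1)) with hw
  have hcross : ∀ i, cross (Γ i) (Γ (i + 1)) = w := fun i =>
    apply_eq_of_succ_eq (f := fun i => cross (Γ i) (Γ (i + 1)))
      (fun i => by simpa using (hΓ (i + 1)).symm) i
  set s := ‖w‖ with hs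
  set c := √(1 - s ^ 2) with hc
  let f : Fin n → ℝ := fun i => inner ℝ (Γ i : E3) (Γ (i + 1) : E3)
  have hf : ∀ i, f i ^ 2 + s ^ 2 = 1 := by
    intro i
    change inner ℝ (Γ i : E3) (Γ (i + 1) : E3) ^ 2 + s ^ 2 = 1
    rw [hs, ← hcross i, ← real_inner_self_eq_norm_sq, inner_cross_cross, inner_self_S2,
      inner_self_S2, real_inner_comm (Γ i : E3)]
    ring
  have hc2 : c ^ 2 = 1 - s ^ 2 := Real.sq_sqrt (by nlinarith [hf 0, sq_nonneg (f 0)])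
  have hd : ∀ m, f (Fin.ofNat n m) = c ∨ f (Fin.ofNat n m) = -c := fun m =>
    sq_eq_sq_iff_eq_or_eq_neg.1 (by linarith [hf (Fin.ofNat n m)])
  obtain ⟨a, b, hab, hsum, hprod⟩ := exists_sum_prod_eq (s := s) hd n
  have hE : energy Γ = ((a : ℝ) - b) * c := by rw [← hsum, sum_range_ofNat f]; rfl
  -- In the collinear case there is no plane of rotation, but `c = 1`.
  by_cases hs0 : s = 0
  · refine ⟨a, by omega, b, by omega, 1, one_pow _, ?_⟩
    rw [hE, hc, hs0]; simp
  -- The closing condition may say nothing about `u` here, but the energy is `0` and any root of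
  -- unity serves.
  by_cases heq : a = b
  · refine ⟨a, by omega, b, by omega, 1, one_pow _, ?_⟩
    rw [hE, heq]; simp
  refine ⟨a, by omega, b, by omega, ⟨c, s⟩, ?_, hE⟩
  refine pow_eq_one_of_mul_eq_one ?_ heq (N := n) ?_ (by omega) (by omega)
  · rw [Complex.mul_conj, Complex.normSq_mk]
    norm_cast
    linarith
  · rw [← hprod]
    have hΓn : (Γ (Fin.ofNat n n) : E3) = Γ (Fin.ofNat n 0) := by
      congr 2
      exact Fin.ext (by simp [Fin.ofNat])
    have hw0 : inner ℝ w (Γ (Fin.ofNat n 0) : E3) = 0 := by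
      rw [← hcross (Fin.ofNat n 0), real_inner_comm, inner_self_cross]
    refine prod_eq_one_of_rotation (g := fun m => (Γ (Fin.ofNat n m) : E3)) (e := s⁻¹ • w)
      ?_ (norm_S2 _) ?_ (fun m => ?_) hΓn
    · rw [norm_smul, norm_inv, ← hs, Real.norm_of_nonneg (norm_nonneg _), inv_mul_cancel₀ hs0]
    · rw [inner_smul_left, hw0, mul_zero]
    · rw [smul_cross, smul_smul, mul_inv_cancel₀ hs0, one_smul, ofNat_add_one,
        ← hcross (Fin.ofNat n m), cross_anticomm (Γ (Fin.ofNat n m) : E3) (cross _ _),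
        cross_cross_right, inner_self_S2]
      module

theorem finite_energy_image_equilibriumSet (hn : 2 ≤ n) :
    (energy '' equilibriumSet n).Finite := by
  have hroots : {u : ℂ | u ^ (2 * n.factorial) = 1}.Finite := by
    have hpos : 0 < 2 * n.factorial := by positivity
    refine (Polynomial.nthRoots (2 * n.factorial) (1 : ℂ)).toFinset.finite_toSet.subset ?_
    intro u hu
    simpa [Polynomial.mem_nthRoots hpos] using hu
  refine (((finite_Iic n).prod ((finite_Iic n).prod hroots)).image
    fun q : ℕ × ℕ × ℂ => ((q.1 : ℝ) - q.2.1) * q.2.2.re).subset ?_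
  rintro _ ⟨Γ, hΓ, rfl⟩
  obtain ⟨a, ha, b, hb, u, hu, h⟩ := exists_energy_eq ((mem_equilibriumSet_iff hn Γ).1 hΓ)
  exact ⟨(a, b, u), ⟨ha, hb, hu⟩, h.symm⟩

/-- A connected subset of a finite set of reals has at most one point. -/
lemma energy_eq_of_isPreconnected (hn : 2 ≤ n) {C : Set (State n)} (hC : IsPreconnected C)
    (hsub : C ⊆ equilibriumSet n) {p q : State n} (hp : p ∈ C) (hq : q ∈ C) :
    energy p = energy q := by
  have h1 := hC.image energy continuous_energy.continuousOn
  have h2 : (energy '' C).Subsingleton :=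
    ((finite_energy_image_equilibriumSet hn).subset (image_mono hsub)).countable.isTotallyDisconnected
      _ Subset.rfl h1
  exact h2 ⟨p, hp, rfl⟩ ⟨q, hq, rfl⟩

/-- The energies of equilibria do not accumulate. -/
lemma exists_energy_gap (hn : 2 ≤ n) (v : ℝ) :
    ∃ η > 0, ∀ p ∈ equilibriumSet n, |energy p - v| < η → energy p = v := by
  have hfin := (finite_energy_image_equilibriumSet hn).subset
    (sdiff_subset (t := ({v} : Set ℝ)))
  obtain ⟨η, hη, hball⟩ := Metric.isOpen_iff.1 hfin.isClosed.isOpen_compl v (by simp)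
  refine ⟨η, hη, fun p hp hlt => ?_⟩
  by_contra hne
  exact hball (show energy p ∈ Metric.ball v η by rwa [Metric.mem_ball, Real.dist_eq])
    ⟨⟨p, hp, rfl⟩, hne⟩

end EnergyValues

/-! ### Möbius maps of the sphere and their second-order effect on an edge. -/

/-- The conformal automorphism of the unit sphere that moves the sphere towards `a`. -/
def moebius (a x : E3) : E3 := ((1 - ‖a‖ ^ 2) / ‖x + a‖ ^ 2) • (x + a) + a

lemma norm_add_sq_of_unit {x : E3} (hx : ‖x‖ = 1) (a : E3) :
    ‖x + a‖ ^ 2 = 1 + 2 * inner ℝ x a + ‖a‖ ^ 2 := by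
  rw [norm_add_sq_real, hx, one_pow]

lemma norm_add_sq_pos {x a : E3} (hx : ‖x‖ = 1) (ha : ‖a‖ < 1) : 0 < ‖x + a‖ ^ 2 := by
  have : x + a ≠ 0 := by
    intro h
    rw [eq_neg_of_add_eq_zero_left h, norm_neg] at hx
    linarith
  positivity

/-- `1 - ⟪x, y⟫` is half the squared chord length, which a conformal map of the sphere multiplies by
the conformal factors at both endpoints. -/
lemma one_sub_inner_moebius {x y a : E3} (hx : ‖x‖ = 1) (hy : ‖y‖ = 1) (ha : ‖a‖ < 1) :
    1 - inner ℝ (moebius a x) (moebius a y)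
      = (1 - inner ℝ x y) * ((1 - ‖a‖ ^ 2) ^ 2 / (‖x + a‖ ^ 2 * ‖y + a‖ ^ 2)) := by
  have hX := (norm_add_sq_pos hx ha).ne'
  have hY := (norm_add_sq_pos hy ha).ne'
  simp only [moebius, inner_add_left, inner_add_right, inner_smul_left, inner_smul_right,
    real_inner_self_eq_norm_sq, conj_trivial]
  have h1 := norm_add_sq_of_unit hx a
  have h2 := norm_add_sq_of_unit hy a
  have h3 : inner ℝ x a = (‖x + a‖ ^ 2 - 1 - ‖a‖ ^ 2) / 2 := by linarith
  have h4 : inner ℝ a y = (‖y + a‖ ^ 2 - 1 - ‖a‖ ^ 2) / 2 := by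
    rw [real_inner_comm]; linarith
  rw [h3, h4]
  generalize ‖x + a‖ ^ 2 = X at *
  generalize ‖y + a‖ ^ 2 = Y at *
  field_simp
  ring

lemma norm_moebius {x a : E3} (hx : ‖x‖ = 1) (ha : ‖a‖ < 1) : ‖moebius a x‖ = 1 := by
  have h := one_sub_inner_moebius hx hx ha
  rw [real_inner_self_eq_norm_sq, real_inner_self_eq_norm_sq, hx] at h
  exact (pow_eq_one_iff_of_nonneg (norm_nonneg _) two_ne_zero).1 (by linarith)

/-- The second-order difference quotient of the conformal factor of an edge. -/
def edgeQuotient (α β t : ℝ) : ℝ :=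
  (8 * (1 + t ^ 2) ^ 2 * (α * β + α ^ 2 + β ^ 2 - 1) - 32 * t ^ 2 * (α * β) * (1 + α * β)) /
    (((1 + t ^ 2) ^ 2 - 4 * t ^ 2 * α ^ 2) * ((1 + t ^ 2) ^ 2 - 4 * t ^ 2 * β ^ 2))

lemma continuousAt_edgeQuotient (α β : ℝ) : ContinuousAt (edgeQuotient α β) 0 := by
  unfold edgeQuotient
  refine ContinuousAt.div (by fun_prop) (by fun_prop) ?_
  norm_num

lemma edgeQuotient_zero (α β : ℝ) : edgeQuotient α β 0 = 8 * (α * β + α ^ 2 + β ^ 2 - 1) := by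
  simp [edgeQuotient]

/-- Adding the contributions of `t` and `-t` cancels the odd orders, leaving a remainder exactly
divisible by `t ^ 2`. -/
lemma conformalFactor_add_eq {α β t : ℝ} (h1 : 1 + t ^ 2 + 2 * (t * α) ≠ 0)
    (h2 : 1 + t ^ 2 + 2 * (t * β) ≠ 0) (h3 : 1 + t ^ 2 + 2 * (-t * α) ≠ 0)
    (h4 : 1 + t ^ 2 + 2 * (-t * β) ≠ 0) :
    (1 - t ^ 2) ^ 2 / ((1 + t ^ 2 + 2 * (t * α)) * (1 + t ^ 2 + 2 * (t * β)))
      + (1 - t ^ 2) ^ 2 / ((1 + t ^ 2 + 2 * (-t * α)) * (1 + t ^ 2 + 2 * (-t * β)))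
      = 2 + t ^ 2 * edgeQuotient α β t := by
  unfold edgeQuotient
  rw [show (1 + t ^ 2) ^ 2 - 4 * t ^ 2 * α ^ 2
      = (1 + t ^ 2 + 2 * (t * α)) * (1 + t ^ 2 + 2 * (-t * α)) by ring,
    show (1 + t ^ 2) ^ 2 - 4 * t ^ 2 * β ^ 2
      = (1 + t ^ 2 + 2 * (t * β)) * (1 + t ^ 2 + 2 * (-t * β)) by ring]
  obtain ⟨A, hA⟩ : ∃ A, A = 1 + t ^ 2 + 2 * (t * α) := ⟨_, rfl⟩
  obtain ⟨B, hB⟩ : ∃ B, B = 1 + t ^ 2 + 2 * (t * β) := ⟨_, rfl⟩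
  obtain ⟨A', hA'⟩ : ∃ A', A' = 1 + t ^ 2 + 2 * (-t * α) := ⟨_, rfl⟩
  obtain ⟨B', hB'⟩ : ∃ B', B' = 1 + t ^ 2 + 2 * (-t * β) := ⟨_, rfl⟩
  rw [← hA] at h1 ⊢
  rw [← hB] at h2 ⊢
  rw [← hA'] at h3 ⊢
  rw [← hB'] at h4 ⊢
  field_simp
  rw [hA, hB, hA', hB']
  ring

lemma norm_smul_single (t : ℝ) (k : Fin 3) :
    ‖t • (EuclideanSpace.single k (1 : ℝ) : E3)‖ = |t| := by
  simp [norm_smul]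

lemma norm_add_smul_single_sq {x : E3} (hx : ‖x‖ = 1) (t : ℝ) (k : Fin 3) :
    ‖x + t • (EuclideanSpace.single k (1 : ℝ) : E3)‖ ^ 2 = 1 + t ^ 2 + 2 * (t * x k) := by
  rw [norm_add_sq_of_unit hx, norm_smul_single, sq_abs, inner_smul_right,
    EuclideanSpace.inner_single_right]
  simp
  ring

lemma one_sub_inner_moebius_add {x y : E3} (hx : ‖x‖ = 1) (hy : ‖y‖ = 1) {t : ℝ} (ht : |t| < 1)
    (k : Fin 3) :
    (1 - inner ℝ (moebius (t • EuclideanSpace.single k (1 : ℝ)) x)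
        (moebius (t • EuclideanSpace.single k (1 : ℝ)) y))
      + (1 - inner ℝ (moebius ((-t) • EuclideanSpace.single k (1 : ℝ)) x)
        (moebius ((-t) • EuclideanSpace.single k (1 : ℝ)) y))
      = (1 - inner ℝ x y) * (2 + t ^ 2 * edgeQuotient (x k) (y k) t) := by
  have ht' : |-t| < 1 := by rwa [abs_neg]
  have hpos : ∀ {z : E3} {s : ℝ}, ‖z‖ = 1 → |s| < 1 → 1 + s ^ 2 + 2 * (s * z k) ≠ 0 := by
    intro z s hz hs
    rw [← norm_add_smul_single_sq hz]
    exact (norm_add_sq_pos hz (by rwa [norm_smul_single])).ne'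
  have h3 := hpos hx ht'
  have h4 := hpos hy ht'
  rw [one_sub_inner_moebius hx hy (by rwa [norm_smul_single]),
    one_sub_inner_moebius hx hy (by rwa [norm_smul_single]), ← mul_add,
    norm_add_smul_single_sq hx, norm_add_smul_single_sq hy, norm_add_smul_single_sq hx,
    norm_add_smul_single_sq hy, norm_smul_single, norm_smul_single, sq_abs, sq_abs]
  rw [neg_sq] at *
  rw [conformalFactor_add_eq (hpos hx ht) (hpos hy ht) h3 h4]

/-- Summed over the axes, the squares give `1` for each of `x` and `y`, so the total is `8 * (⟪x, y⟫
+ 1 + 1 - 3)`. It has a definite sign although the separate axes need not. -/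
lemma sum_edgeQuotient_zero {x y : E3} (hx : ‖x‖ = 1) (hy : ‖y‖ = 1) :
    ∑ k, edgeQuotient (x k) (y k) 0 = -8 * (1 - inner ℝ x y) := by
  have h1 : inner ℝ x x = 1 := by rw [real_inner_self_eq_norm_sq, hx, one_pow]
  have h2 : inner ℝ y y = 1 := by rw [real_inner_self_eq_norm_sq, hy, one_pow]
  rw [inner_eq_coords] at h1 h2
  simp only [edgeQuotient_zero, Fin.sum_univ_three, inner_eq_coords]
  linear_combination 8 * h1 + 8 * h2

lemma tendsto_moebius {x : E3} (hx : ‖x‖ = 1) (k : Fin 3) :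
    Tendsto (fun t : ℝ => moebius (t • EuclideanSpace.single k (1 : ℝ)) x) (𝓝 0) (𝓝 x) := by
  have hc : ContinuousAt (fun t : ℝ => moebius (t • EuclideanSpace.single k (1 : ℝ)) x) 0 := by
    have h1 : ContinuousAt (fun t : ℝ => t • (EuclideanSpace.single k (1 : ℝ) : E3)) 0 := by
      fun_prop
    have h2 := continuousAt_const.add h1 (x := (0 : ℝ)) (f := fun _ => x)
    exact (((continuousAt_const.sub (h1.norm.pow 2)).div (h2.norm.pow 2)
      (by simp [hx])).smul h2).add h1
  have h0 : moebius ((0 : ℝ) • EuclideanSpace.single k (1 : ℝ)) x = x := by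
    simp [moebius, hx]
  have := hc.tendsto
  rwa [h0] at this

/-! ### Perturbing away from non-consensus configurations. -/

section Ring

variable {n : ℕ} [NeZero n]

/-- A configuration of unit vectors which is not in consensus can be perturbed so that the sum of
the inner products of consecutive vectors increases. -/
theorem exists_perturbation {x : Fin n → E3} (hx : ∀ i, ‖x i‖ = 1)
    (hne : ∃ i, inner ℝ (x i) (x (i + 1)) ≠ (1 : ℝ)) {ε : ℝ} (hε : 0 < ε) :
    ∃ y : Fin n → E3, (∀ i, ‖y i‖ = 1) ∧ (∀ i, ‖y i - x i‖ < ε) ∧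
      ∑ i, inner ℝ (x i) (x (i + 1)) < (∑ i, inner ℝ (y i) (y (i + 1)) : ℝ) := by
  -- `t ^ 2 * q t` is the total change of `∑ (1 - ⟪x i, x (i + 1)⟫)` under the six Möbius maps along
  -- `±t` times the axes. At `t = 0`, `q` is `-8` times a sum of squares.
  let q : ℝ → ℝ := fun t =>
    ∑ k : Fin 3, ∑ i, (1 - inner ℝ (x i) (x (i + 1))) * edgeQuotient (x i k) (x (i + 1) k) t
  have hqc : ContinuousAt q 0 := tendsto_finsetSum _ fun k _ => tendsto_finsetSum _ fun i _ =>
    (continuousAt_edgeQuotient _ _).tendsto.const_mul _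
  have hq0 : q 0 < 0 := by
    have h : q 0 = -8 * ∑ i, (1 - inner ℝ (x i) (x (i + 1))) ^ 2 := by
      simp only [q]
      rw [Finset.sum_comm, Finset.mul_sum]
      refine Finset.sum_congr rfl fun i _ => ?_
      rw [← Finset.mul_sum, sum_edgeQuotient_zero (hx _) (hx _)]
      ring
    obtain ⟨j, hj⟩ := hne
    have : 0 < ∑ i, (1 - inner ℝ (x i) (x (i + 1)) : ℝ) ^ 2 :=
      Finset.sum_pos' (fun i _ => sq_nonneg _)
        ⟨j, Finset.mem_univ _, by have := sub_ne_zero.2 (Ne.symm hj); positivity⟩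
    rw [h]; linarith
  have hclose : ∀ᶠ t : ℝ in 𝓝 0, ∀ (k : Fin 3) (i : Fin n),
      ‖moebius (t • EuclideanSpace.single k (1 : ℝ)) (x i) - x i‖ < ε := by
    refine eventually_all.2 fun k => eventually_all.2 fun i => ?_
    have := Metric.tendsto_nhds.1 (tendsto_moebius (hx i) k) ε hε
    simpa only [dist_eq_norm] using this
  have hneg : Tendsto (fun t : ℝ => -t) (𝓝 0) (𝓝 0) := by
    simpa using (continuous_neg (G := ℝ)).tendsto 0
  have hsmall : ∀ᶠ t : ℝ in 𝓝 0, |t| < 1 := by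
    have := Metric.ball_mem_nhds (0 : ℝ) one_pos
    filter_upwards [this] with t ht
    simpa using ht
  have hev := ((hqc.eventually_lt_const hq0).and
    ((hclose.and (hneg.eventually hclose)).and hsmall)).filter_mono
      (nhdsWithin_le_nhds (s := Ioi (0 : ℝ)))
  obtain ⟨t, ⟨hqt, ⟨hc1, hc2⟩, ht1⟩, ht0⟩ := (hev.and self_mem_nhdsWithin).exists
  have ht0 : 0 < t := ht0
  -- If none of the six maps increased the sum, then `q t` would be nonnegative.
  by_contra! hcon
  have hP : ∀ (s : ℝ) (k : Fin 3), |s| < 1 →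
      (∀ i, ‖moebius (s • EuclideanSpace.single k (1 : ℝ)) (x i) - x i‖ < ε) →
      ∑ i, inner ℝ (moebius (s • EuclideanSpace.single k (1 : ℝ)) (x i))
        (moebius (s • EuclideanSpace.single k (1 : ℝ)) (x (i + 1)))
        ≤ ∑ i, inner ℝ (x i) (x (i + 1)) := fun s k hs hcl =>
    hcon _ (fun i => norm_moebius (hx i) (by rwa [norm_smul_single])) hcl
  have hk : ∀ k : Fin 3, 0 ≤ t ^ 2 *
      ∑ i, (1 - inner ℝ (x i) (x (i + 1))) * edgeQuotient (x i k) (x (i + 1) k) t := by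
    intro k
    have h1 := hP t k ht1 (hc1 k)
    have h2 := hP (-t) k (by rwa [abs_neg]) (hc2 k)
    have h3 := Finset.sum_congr (rfl : (Finset.univ : Finset (Fin n)) = Finset.univ)
      fun i _ => one_sub_inner_moebius_add (hx i) (hx (i + 1)) ht1 k
    have h4 : ∀ i, (1 - inner ℝ (x i) (x (i + 1)))
        * (2 + t ^ 2 * edgeQuotient (x i k) (x (i + 1) k) t)
        = 2 * (1 - inner ℝ (x i) (x (i + 1))) + t ^ 2 *
          ((1 - inner ℝ (x i) (x (i + 1))) * edgeQuotient (x i k) (x (i + 1) k) t) := by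
      intro i; ring
    simp only [h4, Finset.sum_add_distrib, Finset.sum_sub_distrib, ← Finset.mul_sum] at h3
    linarith
  have hsum : 0 ≤ t ^ 2 * q t := by
    simp only [q]
    rw [Finset.mul_sum]
    exact Finset.sum_nonneg fun k _ => hk k
  have : t ^ 2 * q t < 0 := mul_neg_of_pos_of_neg (by positivity) hqt
  linarith

end Ring

/-! ### The antipodal manifold, its stability and the instability of everything else. -/

section Antipodal

variable {n : ℕ} [NeZero n]

lemma neg_one_pow_val_add_one (hn : 2 ≤ n) (hn_even : Even n) (i : Fin n) :
    (-1 : ℝ) ^ ((i + 1 : Fin n) : ℕ) = -(-1) ^ (i : ℕ) := by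
  have h1 : ((1 : Fin n) : ℕ) = 1 := by
    rw [Fin.val_one']; exact Nat.mod_eq_of_lt (by omega)
  rw [Fin.val_add, h1]
  rcases Nat.lt_or_ge (i + 1 : ℕ) n with h | h
  · rw [Nat.mod_eq_of_lt h, pow_succ]; ring
  · have h2 : (i : ℕ) + 1 = n := by omega
    have h3 : (-1 : ℝ) ^ ((i : ℕ) + 1) = 1 := by rw [h2]; exact hn_even.neg_one_pow
    rw [h2, Nat.mod_self, pow_zero]
    rw [pow_succ] at h3
    linarith

lemma neg_one_pow_mul_self (m : ℕ) : (-1 : ℝ) ^ m * (-1) ^ m = 1 := by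
  rw [← mul_pow]; norm_num

lemma neg_one_le_inner (x y : S2) : (-1 : ℝ) ≤ inner ℝ (x : E3) (y : E3) := by
  have habs := abs_real_inner_le_norm (x : E3) (y : E3)
  rw [norm_S2, norm_S2, one_mul, abs_le] at habs
  exact habs.1

lemma energy_add_eq_sum (Γ : State n) :
    energy Γ + n = ∑ i, (inner ℝ (Γ i : E3) (Γ (i + 1) : E3) + 1) := by
  simp [energy, Finset.sum_add_distrib]

lemma neg_le_energy (Γ : State n) : -(n : ℝ) ≤ energy Γ := by
  have h : 0 ≤ energy Γ + n := by
    rw [energy_add_eq_sum]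
    exact Finset.sum_nonneg fun i _ => by linarith [neg_one_le_inner (Γ i) (Γ (i + 1))]
  linarith

lemma energy_eq_neg_iff (Γ : State n) :
    energy Γ = -n ↔ ∀ i, inner ℝ (Γ i : E3) (Γ (i + 1) : E3) = (-1 : ℝ) := by
  rw [← add_eq_zero_iff_eq_neg, energy_add_eq_sum, Finset.sum_eq_zero_iff_of_nonneg
    (fun i _ => by linarith [neg_one_le_inner (Γ i) (Γ (i + 1))])]
  simp [add_eq_zero_iff_eq_neg]

/-- The antipodal formations are the minimizers of the energy. -/
theorem mem_antipodalManifold_iff (hn : 2 ≤ n) (hn_even : Even n) (Γ : State n) :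
    Γ ∈ antipodalManifold n ↔ energy Γ = -n := by
  rw [energy_eq_neg_iff]
  constructor
  · rintro ⟨v, hv⟩ i
    rw [hv, hv, inner_smul_left, inner_smul_right, inner_self_S2,
      neg_one_pow_val_add_one hn hn_even]
    have := neg_one_pow_mul_self (i : ℕ)
    simp only [conj_trivial]
    linarith
  · intro h
    have hneg : ∀ i, (Γ (i + 1) : E3) = -Γ i := fun i =>
      (neg_eq_iff_eq_neg.2 ((inner_eq_neg_one_iff_of_norm_eq_one (norm_S2 _) (norm_S2 _)).1
        (h i))).symm
    refine ⟨Γ 0, fun i => ?_⟩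
    have hconst := apply_eq_of_succ_eq (f := fun i : Fin n => (-1 : ℝ) ^ (i : ℕ) • (Γ i : E3))
      (fun i => by
        rw [hneg, neg_one_pow_val_add_one hn hn_even, smul_neg, neg_smul, neg_neg]) i
    simp only [Fin.val_zero, pow_zero, one_smul] at hconst
    rw [← hconst, smul_smul, neg_one_pow_mul_self, one_smul]

lemma antipodalManifold_subset (hn : 2 ≤ n) :
    antipodalManifold n ⊆ equilibriumSet n := by
  rintro Γ ⟨v, hv⟩
  rw [mem_equilibriumSet_iff hn]
  intro i
  simp only [hv, cross_smul, smul_cross, cross_self_eq_zero, smul_zero]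

lemma isConnected_antipodalManifold {n : ℕ} : IsConnected (antipodalManifold n) := by
  have hunit : ∀ (i : Fin n) (v : S2), (-1 : ℝ) ^ (i : ℕ) • (v : E3) ∈ Metric.sphere (0 : E3) 1 := by
    intro i v
    simp [norm_smul]
  let g : S2 → State n := fun v i => ⟨(-1 : ℝ) ^ (i : ℕ) • (v : E3), hunit i v⟩
  have hg : Continuous g := continuous_pi fun i =>
    (continuous_subtype_val.const_smul ((-1 : ℝ) ^ (i : ℕ))).subtype_mk _
  have hS : IsConnected (Metric.sphere (0 : E3) 1) := by
    refine isConnected_sphere ?_ 0 zero_le_one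
    rw [← Module.finrank_eq_rank, finrank_euclideanSpace_fin]
    norm_num
  have : ConnectedSpace S2 := isConnected_iff_connectedSpace.1 hS
  have hrange : antipodalManifold n = range g := by
    ext Γ
    constructor
    · rintro ⟨v, hv⟩
      exact ⟨v, funext fun i => Subtype.ext (hv i).symm⟩
    · rintro ⟨v, rfl⟩
      exact ⟨v, fun _ => rfl⟩
  rw [hrange]
  exact isConnected_range hg

/-- A component has constant energy, so the one meeting the antipodal manifold contains only
minimizers. -/
theorem isEquilibriumManifold_antipodalManifold (hn : 2 ≤ n) (hn_even : Even n) :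
    IsEquilibriumManifold (antipodalManifold n) := by
  have hsub := antipodalManifold_subset hn
  obtain ⟨p, hp⟩ := (isConnected_antipodalManifold (n := n)).nonempty
  refine ⟨p, hsub hp, Subset.antisymm
    (isConnected_antipodalManifold.isPreconnected.subset_connectedComponentIn hp hsub) ?_⟩
  intro q hq
  rw [mem_antipodalManifold_iff hn hn_even] at hp ⊢
  rw [← hp]
  exact energy_eq_of_isPreconnected hn isPreconnected_connectedComponentIn
    (connectedComponentIn_subset _ _) hq (mem_connectedComponentIn (hsub (by
      rwa [mem_antipodalManifold_iff hn hn_even])))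

/-- The energy is uniformly continuous with respect to the distance to a set on which it is
constant. -/
lemma exists_abs_energy_sub_lt {M : Set (State n)} (hM : M.Nonempty) {v : ℝ}
    (hv : ∀ p ∈ M, energy p = v) {η : ℝ} (hη : 0 < η) :
    ∃ δ > 0, ∀ Γ : State n, distTo M Γ < δ → |energy Γ - v| < η := by
  obtain ⟨δ, hδ, h⟩ := Metric.uniformContinuous_iff.1
    (CompactSpace.uniformContinuous_of_continuous (continuous_energy (n := n))) η hη
  refine ⟨δ, hδ, fun Γ hΓ => ?_⟩
  obtain ⟨p, hp, hd⟩ := exists_dist_lt_of_distTo_lt hM hΓ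
  have := h hd
  rwa [hv p hp, Real.dist_eq] at this

/-- On the compact complement of a neighbourhood of the minimizers, the energy stays above its
minimum by a definite amount. -/
lemma exists_distTo_lt_of_energy_lt (hn : 2 ≤ n) (hn_even : Even n) {ε : ℝ} (hε : 0 < ε) :
    ∃ η > 0, ∀ Γ : State n, energy Γ < -n + η → distTo (antipodalManifold n) Γ < ε := by
  have hpi := Real.pi_pos
  set r := ε / (Real.pi / 2) with hr
  have hr0 : 0 < r := by positivity
  set F := (Metric.thickening r (antipodalManifold n))ᶜ with hF
  have hFc : IsCompact F := Metric.isOpen_thickening.isClosed_compl.isCompact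
  have hlt : ∀ Γ ∉ F, distTo (antipodalManifold n) Γ < ε := by
    intro Γ hΓ
    obtain ⟨z, hz, hd⟩ := Metric.mem_thickening_iff.1 (not_not.1 hΓ)
    refine (distTo_le hz Γ).trans_lt ?_
    rw [hr, lt_div_iff₀ (by positivity)] at hd
    linarith
  rcases F.eq_empty_or_nonempty with hemp | hne
  · exact ⟨1, one_pos, fun Γ _ => hlt Γ (by rw [hemp]; exact notMem_empty _)⟩
  · obtain ⟨q, hq, hmin⟩ := hFc.exists_isMinOn hne continuous_energy.continuousOn
    have hqne : energy q ≠ -n := fun h =>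
      hq (Metric.self_subset_thickening hr0 _ ((mem_antipodalManifold_iff hn hn_even q).2 h))
    have hpos : -(n : ℝ) < energy q := lt_of_le_of_ne (neg_le_energy q) (Ne.symm hqne)
    refine ⟨energy q + n, by linarith, fun Γ hΓ => hlt Γ fun hΓF => ?_⟩
    have := isMinOn_iff.1 hmin Γ hΓF
    linarith

theorem isStable_antipodalManifold (hn : 2 ≤ n) (hn_even : Even n) :
    IsStable (antipodalManifold n) := by
  intro ε hε
  obtain ⟨η, hη, h⟩ := exists_distTo_lt_of_energy_lt hn hn_even hε
  obtain ⟨δ, hδ, hd⟩ := exists_abs_energy_sub_lt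
    (isConnected_antipodalManifold (n := n)).nonempty
    (fun p hp => (mem_antipodalManifold_iff hn hn_even p).1 hp) hη
  refine ⟨δ, hδ, fun Γ hΓ h0 t ht => h _ ?_⟩
  have h1 := (abs_lt.1 (hd _ h0)).2
  have h2 : energy (Γ t) ≤ energy (Γ 0) := antitoneOn_energy hn hΓ self_mem_Ici ht ht
  linarith

theorem isAsymptoticallyStable_antipodalManifold (hn : 2 ≤ n) (hn_even : Even n) :
    IsAsymptoticallyStable (antipodalManifold n) := by
  refine ⟨isStable_antipodalManifold hn hn_even, ?_⟩
  -- Starting within `η` of the minimum, the energy never rises, so every limit point is an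
  -- equilibrium inside the gap and hence a minimizer.
  obtain ⟨η, hη, hgap⟩ := exists_energy_gap (n := n) hn (-n)
  obtain ⟨δ, hδ, hd⟩ := exists_abs_energy_sub_lt
    (isConnected_antipodalManifold (n := n)).nonempty
    (fun p hp => (mem_antipodalManifold_iff hn hn_even p).1 hp) hη
  refine ⟨δ, hδ, fun Γ hΓ h0 => approaches_of_limitSet_subset fun p hp => ?_⟩
  obtain ⟨v, hv, hle⟩ := exists_tendsto_energy hn hΓ
  rw [mem_antipodalManifold_iff hn hn_even]
  refine hgap p (limitSet_subset_equilibriumSet hn hΓ hp) ?_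
  have h1 := (abs_lt.1 (hd _ h0)).2
  have h2 := hle 0 le_rfl
  have h3 := neg_le_energy p
  rw [energy_eq_of_mem_limitSet hv hp] at h3 ⊢
  rw [abs_of_nonneg (by linarith)]
  linarith

/-- Only the antipodal formations are local minimizers of the energy. -/
theorem exists_energy_lt (hn : 2 ≤ n) (hn_even : Even n) {Γ : State n}
    (hΓ : Γ ∉ antipodalManifold n) {ε : ℝ} (hε : 0 < ε) :
    ∃ Γ' : State n, dist Γ' Γ < ε ∧ energy Γ' < energy Γ := by
  -- The alternating sign negates every edge, including the closing one because `n` is even, and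
  -- turns antipodal formations into consensus.
  have hflip : ∀ y : Fin n → E3,
      ∑ i : Fin n, inner ℝ ((-1 : ℝ) ^ (i : ℕ) • y i)
        ((-1 : ℝ) ^ ((i + 1 : Fin n) : ℕ) • y (i + 1)) = (-∑ i, inner ℝ (y i) (y (i + 1)) : ℝ) := by
    intro y
    rw [← Finset.sum_neg_distrib]
    refine Finset.sum_congr rfl fun i _ => ?_
    rw [neg_one_pow_val_add_one hn hn_even, inner_smul_left, inner_smul_right, ← mul_assoc,
      conj_trivial, mul_neg, neg_one_pow_mul_self]
    ring
  have hnorm : ∀ (m : ℕ) (z : E3), ‖(-1 : ℝ) ^ m • z‖ = ‖z‖ := fun m z => by simp [norm_smul]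
  have hne : ∃ i : Fin n, inner ℝ ((-1 : ℝ) ^ (i : ℕ) • (Γ i : E3))
      ((-1 : ℝ) ^ ((i + 1 : Fin n) : ℕ) • (Γ (i + 1) : E3)) ≠ (1 : ℝ) := by
    by_contra! hcon
    refine hΓ ((mem_antipodalManifold_iff hn hn_even Γ).2 ?_)
    have h1 := hflip fun i => (Γ i : E3)
    rw [Finset.sum_congr rfl fun i _ => hcon i] at h1
    simp only [Finset.sum_const, Finset.card_univ, Fintype.card_fin, nsmul_eq_mul, mul_one] at h1
    unfold energy
    linarith
  obtain ⟨y, hy1, hyd, hys⟩ := exists_perturbation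
    (x := fun i => (-1 : ℝ) ^ (i : ℕ) • (Γ i : E3)) (fun i => by rw [hnorm, norm_S2]) hne hε
  refine ⟨fun i => ⟨(-1 : ℝ) ^ (i : ℕ) • y i, by simp [norm_smul, hy1]⟩, ?_, ?_⟩
  · refine (dist_pi_lt_iff hε).2 fun i => ?_
    rw [Subtype.dist_eq, dist_eq_norm, ← hnorm i, smul_sub, smul_smul, neg_one_pow_mul_self,
      one_smul]
    exact hyd i
  · rw [hflip fun i => (Γ i : E3)] at hys
    have := hflip y
    unfold energy
    simp only
    linarith

/-- A set of equilibria of constant energy which is not contained in the antipodal manifold is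
unstable. -/
theorem not_isStable (hn : 2 ≤ n) (hn_even : Even n) {M : Set (State n)} {p : State n}
    (hp : p ∈ M) (hconst : ∀ q ∈ M, energy q = energy p) (hpn : p ∉ antipodalManifold n) :
    ¬ IsStable M := by
  intro hstable
  obtain ⟨η, hη, hgap⟩ := exists_energy_gap (n := n) hn (energy p)
  obtain ⟨ε, hε, hclose⟩ := exists_abs_energy_sub_lt ⟨p, hp⟩ hconst (half_pos hη)
  obtain ⟨δ, hδ, hδs⟩ := hstable ε hε
  have hpi := Real.pi_pos
  obtain ⟨Γ₀, hd, hlt⟩ := exists_energy_lt hn hn_even hpn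
    (ε := δ / (Real.pi / 2)) (by positivity)
  obtain ⟨Γ, hΓ, h0⟩ := exists_trajectory Γ₀
  have hstay := hδs Γ hΓ (by
    rw [h0]
    refine (distTo_le hp Γ₀).trans_lt ?_
    rw [lt_div_iff₀ (by positivity)] at hd
    linarith)
  obtain ⟨v, hv, hle⟩ := exists_tendsto_energy hn hΓ
  obtain ⟨q, hq⟩ := limitSet_nonempty Γ
  have hqv := energy_eq_of_mem_limitSet hv hq
  -- The limit energy is strictly below that of `p`, while stability would keep it within `η / 2`;
  -- the gap excludes an equilibrium there.
  have hupper : v < energy p := (hle 0 le_rfl).trans_lt (by rwa [h0])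
  have hlower : energy p - η / 2 ≤ v := by
    refine ge_of_tendsto hv ?_
    filter_upwards [eventually_ge_atTop 0] with t ht
    linarith [(abs_lt.1 (hclose _ (hstay t ht))).1]
  have := hgap q (limitSet_subset_equilibriumSet hn hΓ hq) (by
    rw [hqv, abs_lt]
    constructor <;> linarith)
  linarith

end Antipodal

end AttitudeRing

end

theorem mainTheorem3 (n : ℕ) [NeZero n] (hn : 2 ≤ n) (hn_even : Even n) :
    AttitudeRing.equilibriumSet n =
        {Γ : AttitudeRing.State n | ∀ i : Fin n,
          AttitudeRing.cross (Γ (i - 1)) (Γ i) = AttitudeRing.cross (Γ i) (Γ (i + 1))} ∧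
      (∀ Γ : ℝ → AttitudeRing.State n, AttitudeRing.IsTrajectory Γ →
        ∃ C : Set (AttitudeRing.State n),
          AttitudeRing.IsEquilibriumManifold C ∧ AttitudeRing.Approaches Γ C) ∧
      AttitudeRing.IsEquilibriumManifold (AttitudeRing.antipodalManifold n) ∧
      AttitudeRing.IsAsymptoticallyStable (AttitudeRing.antipodalManifold n) ∧
      (∀ C : Set (AttitudeRing.State n), AttitudeRing.IsEquilibriumManifold C →
        C ≠ AttitudeRing.antipodalManifold n → ¬ AttitudeRing.IsStable C) ∧
      (∀ Γ ∈ AttitudeRing.equilibriumSet n, Γ ∉ AttitudeRing.antipodalManifold n →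
        ¬ AttitudeRing.IsStable {Γ}) := by
  open AttitudeRing in
  refine ⟨Set.ext (mem_equilibriumSet_iff hn),
    fun Γ hΓ => exists_approaches_equilibriumManifold hn hΓ,
    isEquilibriumManifold_antipodalManifold hn hn_even,
    isAsymptoticallyStable_antipodalManifold hn hn_even, ?_, ?_⟩
  · rintro _ ⟨p, hp, rfl⟩ hne
    refine not_isStable hn hn_even (mem_connectedComponentIn hp) (fun q hq =>
      energy_eq_of_isPreconnected hn isPreconnected_connectedComponentIn
        (connectedComponentIn_subset _ _) hq (mem_connectedComponentIn hp)) fun hpn => hne ?_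
    -- Components that share the point `p` coincide, so a component different from the antipodal
    -- manifold does not have `p` in it.
    obtain ⟨q, _, hq⟩ := isEquilibriumManifold_antipodalManifold hn hn_even
    rw [hq] at hpn ⊢
    exact connectedComponentIn_eq hpn |>.symm
  · intro Γ _ hne
    exact not_isStable hn hn_even (Set.mem_singleton Γ)
      (fun q hq => by rw [Set.mem_singleton_iff.1 hq]) hne
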